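/- For a partially ordered set $\mathcal P=(X,P)$ on a nonempty finite set $X$, the (Dushnik–Miller) dimension $\dim(\mathcal P)$ is the least positive integer $k$ such that $P$ is the intersection of $k$ linear extensions of $P$, that is, there are linear orders $P_1,\dots,P_k$ on $X$, each containing $P$, with $(x,y)\in P \iff (x,y)\in P_i$ for all $1\le i\le k$. **Corollary.** There is a polynomial-time $O\!\left(\frac{n\sqrt{\log\log n}}{\sqrt{\log n}}\right)$-factor approximation algorithm for the dimension of an $n$-element poset. That is, there are a function $\rho:\mathbb N\to\mathbb R$ with $\rho(n)=O\!\left(\frac{n\sqrt{\log\log n}}{\sqrt{\log n}}\right)$ as $n\to\infty$ and a deterministic polynomial-time algorithm (a program of a unit-cost random access machine with addition and subtraction) which, given any poset $\mathcal P$ on $n\ge 1$ elements by the $n\times n$ matrix of its order relation, outputs an integer $d$ with $$\dim(\mathcal P)\;\le\; d\;\le\;\rho(n)\cdot\dim(\mathcal P).$$ -/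

import Mathlib

/-! ### The Dushnik–Miller dimension of a poset -/

/-- The relation `r` is a linear extension of the partial order of `α`. -/
structure IsLinearExtension (α : Type*) [PartialOrder α] (r : α → α → Prop) : Prop where
  refl : ∀ x, r x x
  antisymm : ∀ x y, r x y → r y x → x = y
  trans : ∀ x y z, r x y → r y z → r x z
  total : ∀ x y, r x y ∨ r y x
  extends_le : ∀ x y, x ≤ y → r x y

/-- The partial order of `α` is the intersection of the `k` linear extensions `L 0, …, L (k - 1)`. -/
def IsRealizer (α : Type*) [PartialOrder α] {k : ℕ} (L : Fin k → α → α → Prop) : Prop :=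
  (∀ i, IsLinearExtension α (L i)) ∧ ∀ x y, x ≤ y ↔ ∀ i, L i x y

/-- The dimension of a poset: the least positive integer `k` such that the partial order is the
intersection of `k` linear extensions. (For a finite poset such a `k` exists, see
`exists_isRealizer`.) -/
noncomputable def posetDim (α : Type*) [PartialOrder α] : ℕ :=
  sInf {k : ℕ | 0 < k ∧ ∃ L : Fin k → α → α → Prop, IsRealizer α L}

/-- If `y ≤ x` fails, then some linear extension puts `x` before `y`. -/
theorem exists_linearExtension {α : Type*} [PartialOrder α] (x y : α) (h : ¬ y ≤ x) :
    ∃ r : α → α → Prop, IsLinearExtension α r ∧ r x y := by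
  let r₀ : α → α → Prop := fun a b => a ≤ b ∨ (a ≤ x ∧ y ≤ b)
  have : IsPartialOrder α r₀ :=
    { refl := fun a => Or.inl le_rfl
      trans := by
        rintro a b c (h1 | ⟨h1, h2⟩) (h3 | ⟨h3, h4⟩)
        · exact Or.inl (h1.trans h3)
        · exact Or.inr ⟨h1.trans h3, h4⟩
        · exact Or.inr ⟨h1, h2.trans h3⟩
        · exact absurd (h2.trans h3) h
      antisymm := by
        rintro a b (h1 | ⟨h1, h2⟩) (h3 | ⟨h3, h4⟩)
        · exact le_antisymm h1 h3
        · exact absurd ((h4.trans h1).trans h3) h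
        · exact absurd ((h2.trans h3).trans h1) h
        · exact absurd (h2.trans h3) h }
  obtain ⟨s, hs, hle⟩ := extend_partialOrder r₀
  exact ⟨s, ⟨fun a => hs.refl a, fun a b => hs.antisymm a b, fun a b c => hs.trans a b c,
    fun a b => hs.total a b, fun a b hab => hle a b (Or.inl hab)⟩, hle x y (Or.inr ⟨le_rfl, le_rfl⟩)⟩

/-- Every finite poset has a realizer, so `posetDim` is attained. -/
theorem exists_isRealizer (α : Type*) [PartialOrder α] [Finite α] :
    ∃ k : ℕ, 0 < k ∧ ∃ L : Fin k → α → α → Prop, IsRealizer α L := by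
  classical
  have hex : ∀ p : α × α, ∃ r : α → α → Prop, IsLinearExtension α r ∧ (¬ p.2 ≤ p.1 → r p.1 p.2) := by
    rintro ⟨x, y⟩
    by_cases h : y ≤ x
    · obtain ⟨s, hs, hle⟩ := extend_partialOrder ((· ≤ ·) : α → α → Prop)
      exact ⟨s, ⟨fun a => hs.refl a, fun a b => hs.antisymm a b, fun a b c => hs.trans a b c,
        fun a b => hs.total a b, fun a b hab => hle a b hab⟩, fun h' => absurd h h'⟩
    · obtain ⟨r, hr, hxy⟩ := exists_linearExtension x y h
      exact ⟨r, hr, fun _ => hxy⟩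
  choose R hR hR' using hex
  rcases isEmpty_or_nonempty α with hα | ⟨⟨a⟩⟩
  · refine ⟨1, one_pos, fun _ _ _ => True, fun _ => ?_, fun x => hα.elim x⟩
    exact ⟨fun x => hα.elim x, fun x => hα.elim x, fun x => hα.elim x, fun x => hα.elim x,
      fun x => hα.elim x⟩
  · obtain ⟨k, ⟨e⟩⟩ := Finite.exists_equiv_fin (α × α)
    refine ⟨k, Fin.pos (e (a, a)), fun i => R (e.symm i), fun i => hR _, fun x y => ?_⟩
    refine ⟨fun h i => (hR _).extends_le x y h, fun h => ?_⟩
    by_contra hxy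
    have h1 := hR' (y, x) hxy
    have h2 : R (e.symm (e (y, x))) x y := h (e (y, x))
    rw [Equiv.symm_apply_apply] at h2
    exact hxy (le_of_eq ((hR _).antisymm x y h2 h1))

/-! ### Random access machines and polynomial time

Programs of a random access machine in structured form. The store consists of variables and
arrays of natural numbers. The arithmetic is addition and truncated subtraction only, so that a
computation of cost `t` produces only numbers of `O(t)` bits beyond those in the input, and unit
costs are polynomially related to the running time of Turing machines. -/

namespace RAM

/-- The contents of the variables and of the arrays. -/
@[ext] structure Store where
  var : ℕ → ℕ
  arr : ℕ → ℕ → ℕ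

/-- Expressions: constants, variables, array entries, sums and truncated differences. -/
inductive Expr where
  | const (c : ℕ)
  | var (x : ℕ)
  | get (a : ℕ) (i : Expr)
  | add (e₁ e₂ : Expr)
  | sub (e₁ e₂ : Expr)

/-- The value of an expression. -/
def Expr.eval (s : Store) : Expr → ℕ
  | .const c => c
  | .var x => s.var x
  | .get a i => s.arr a (i.eval s)
  | .add e₁ e₂ => e₁.eval s + e₂.eval s
  | .sub e₁ e₂ => e₁.eval s - e₂.eval s

/-- The cost of evaluating an expression: one unit for each of its nodes. -/
def Expr.cost : Expr → ℕ
  | .const _ => 1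
  | .var _ => 1
  | .get _ i => i.cost + 1
  | .add e₁ e₂ => e₁.cost + e₂.cost + 1
  | .sub e₁ e₂ => e₁.cost + e₂.cost + 1

/-- Programs. -/
inductive Prog where
  | skip
  | assign (x : ℕ) (e : Expr)
  | put (a : ℕ) (i e : Expr)
  | seq (p q : Prog)
  | cond (e : Expr) (p q : Prog)
  | loop (e : Expr) (p : Prog)

/-- Assignment to the variable `x`. -/
def Store.setVar (s : Store) (x v : ℕ) : Store :=
  { s with var := Function.update s.var x v }

/-- Assignment to the entry `i` of the array `a`. -/
def Store.setArr (s : Store) (a i v : ℕ) : Store :=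
  { s with arr := Function.update s.arr a (Function.update (s.arr a) i v) }

/-- `Exec p s t s'`: the program `p`, started in the store `s`, halts after exactly `t` units of
time in the store `s'`. The test of `cond` and `loop` is whether the value is nonzero. -/
inductive Exec : Prog → Store → ℕ → Store → Prop
  | skip (s : Store) : Exec .skip s 1 s
  | assign (s : Store) (x : ℕ) (e : Expr) :
      Exec (.assign x e) s (e.cost + 1) (s.setVar x (e.eval s))
  | put (s : Store) (a : ℕ) (i e : Expr) :
      Exec (.put a i e) s (i.cost + e.cost + 1) (s.setArr a (i.eval s) (e.eval s))
  | seq {p q : Prog} {s s' s'' : Store} {t t' : ℕ} :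
      Exec p s t s' → Exec q s' t' s'' → Exec (.seq p q) s (t + t') s''
  | cond_true {e : Expr} {p q : Prog} {s s' : Store} {t : ℕ} :
      e.eval s ≠ 0 → Exec p s t s' → Exec (.cond e p q) s (e.cost + 1 + t) s'
  | cond_false {e : Expr} {p q : Prog} {s s' : Store} {t : ℕ} :
      e.eval s = 0 → Exec q s t s' → Exec (.cond e p q) s (e.cost + 1 + t) s'
  | loop_true {e : Expr} {p : Prog} {s s' s'' : Store} {t t' : ℕ} :
      e.eval s ≠ 0 → Exec p s t s' → Exec (.loop e p) s' t' s'' →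
        Exec (.loop e p) s (e.cost + 1 + t + t') s''
  | loop_false {e : Expr} {p : Prog} {s : Store} :
      e.eval s = 0 → Exec (.loop e p) s (e.cost + 1) s

/-- The machine is deterministic. -/
theorem Exec.det {p : Prog} {s s₁ s₂ : Store} {t₁ t₂ : ℕ} (h₁ : Exec p s t₁ s₁)
    (h₂ : Exec p s t₂ s₂) : t₁ = t₂ ∧ s₁ = s₂ := by
  induction h₁ generalizing t₂ s₂ with
  | skip s => cases h₂; exact ⟨rfl, rfl⟩
  | assign s x e => cases h₂; exact ⟨rfl, rfl⟩
  | put s a i e => cases h₂; exact ⟨rfl, rfl⟩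
  | seq _ _ ih ih' =>
    cases h₂ with
    | seq k k' =>
      obtain ⟨rfl, rfl⟩ := ih k
      obtain ⟨rfl, rfl⟩ := ih' k'
      exact ⟨rfl, rfl⟩
  | cond_true he _ ih =>
    cases h₂ with
    | cond_true _ k => obtain ⟨rfl, rfl⟩ := ih k; exact ⟨rfl, rfl⟩
    | cond_false he' _ => exact absurd he' he
  | cond_false he _ ih =>
    cases h₂ with
    | cond_true he' _ => exact absurd he he'
    | cond_false _ k => obtain ⟨rfl, rfl⟩ := ih k; exact ⟨rfl, rfl⟩
  | loop_true he _ _ ih ih' =>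
    cases h₂ with
    | loop_true _ k k' =>
      obtain ⟨rfl, rfl⟩ := ih k
      obtain ⟨rfl, rfl⟩ := ih' k'
      exact ⟨rfl, rfl⟩
    | loop_false he' => exact absurd he' he
  | loop_false he =>
    cases h₂ with
    | loop_true he' _ _ => exact absurd he he'
    | loop_false _ => exact ⟨rfl, rfl⟩

/-- The initial store on the input word `w`: variable `0` holds the length of `w`, array `0` holds
the bits of `w`, everything else is `0`. -/
def input (w : List Bool) : Store where
  var x := if x = 0 then w.length else 0
  arr a i := if a = 0 then (w.getD i false).toNat else 0

/-- The function `f` is computable in polynomial time, where its arguments are presented as words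
over `{0, 1}` by `enc`: one program halts, on every input, within a number of steps polynomial in
the length of the input word, with the value of `f` in variable `0`. -/
def PolyTimeComputable {α : Type*} (enc : α → List Bool) (f : α → ℕ) : Prop :=
  ∃ (p : Prog) (T : Polynomial ℕ), ∀ a : α, ∃ (t : ℕ) (s : Store),
    Exec p (input (enc a)) t s ∧ t ≤ T.eval (enc a).length ∧ s.var 0 = f a

end RAM

/-! ### Finite posets as inputs of an algorithm -/

/-- A nonempty finite poset, with its elements labelled `0, …, card - 1`. -/
structure FinitePoset where
  card : ℕ
  card_pos : 0 < card
  order : PartialOrder (Fin card)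

namespace FinitePoset

/-- The dimension of a finite poset. -/
noncomputable def dim (P : FinitePoset) : ℕ :=
  @posetDim (Fin P.card) P.order

open Classical in
/-- A poset on `n` elements is written as the word `1ⁿ0` followed by the `n * n` bits of the matrix
of its order relation, row by row. -/
noncomputable def encode (P : FinitePoset) : List Bool :=
  List.replicate P.card true ++ false ::
    (List.finRange P.card).flatMap fun i =>
      (List.finRange P.card).map fun j => decide (P.order.le i j)

end FinitePoset

/-! Cut the poset `P` into blocks of `k` consecutive elements. For a block `e`, consider families of
rank functions such that, whenever `e b ≰ y`, one of them ranks `e b` above all members of the block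
below `y`. Ranking the block along the members of a realizer gives such a family, so at most `dim P`
rank functions are needed. Conversely, each rank function induces a linear extension of `P`, and
the linear extensions obtained from all blocks, together with an arbitrary one, form a realizer.
Hence the numbers of rank functions needed for the blocks, plus one, add up to a number between
`dim P` and `(n / k + 2) * dim P`.

At most `k` rank functions with values less than `k` are needed for a block, so the numbers below
`k ^ (k * k)` encode all the families to be tried. If `k` is the largest number with
`k ^ (k * k) ≤ N`, where `N` is the length of the input, then the search takes polynomial time.
Since `k² log k` is about `log n`, the factor `n / k + 2` is `O(n √(log log n) / √(log n))`.

The functions computable in polynomial time are closed under recursion, sums and quantifiers whose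
bounds do not exceed the length of the input, so that no program for the whole search has to be
written down.
-/

/-! ### Reversal numbers -/

section Reversal

variable {α β ι : Type*} [PartialOrder α] {e : β → α}

theorem exists_linearExtension_of_monotone {γ : Type*} [LinearOrder γ] {h : α → γ}
    (hh : Monotone h) :
    ∃ L : α → α → Prop, IsLinearExtension α L ∧ ∀ x y, h y < h x → ¬ L x y := by
  let key : α → γ ×ₗ LinearExtension α := fun x => toLex (h x, toLinearExtension x)
  have key_mono : ∀ x y, x ≤ y → key x ≤ key y := fun x y hxy =>
    Prod.Lex.toLex_mono ⟨hh hxy, toLinearExtension.monotone hxy⟩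
  have key_injective : Function.Injective key := fun x y hxy =>
    (Prod.ext_iff.1 (toLex.injective hxy)).2
  refine ⟨fun x y => key x ≤ key y, ⟨fun x => le_rfl, fun x y hxy hyx =>
    key_injective (le_antisymm hxy hyx), fun x y z => le_trans, fun x y => le_total _ _,
    key_mono⟩, fun x y hxy => not_le.2 (Prod.Lex.toLex_lt_toLex.2 (Or.inl hxy))⟩

/-- The linear extensions obtained by ordering the family `e` according to the rank functions `r i`
reverse every pair `e b ≰ y`: some `r i` ranks `e b` above all members of the family below `y`. -/
def RanksReverse (e : β → α) (r : ι → β → ℕ) : Prop :=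
  ∀ b y, ¬ e b ≤ y → ∃ i, ∀ b', e b' ≤ y → r i b' < r i b

/-- The least number of rank functions on the family `e` that reverse every pair `e b ≰ y`. It is
the contribution of the family to an upper bound for the dimension, and it is itself bounded by the
dimension. -/
noncomputable def reversalNumber (e : β → α) : ℕ :=
  sInf {t : ℕ | ∃ r : Fin t → β → ℕ, RanksReverse e r}

theorem exists_linearExtension_of_rank [Finite β] (e : β → α) (r : β → ℕ) :
    ∃ L : α → α → Prop, IsLinearExtension α L ∧
      ∀ b y, (∀ b', e b' ≤ y → r b' < r b) → ¬ L (e b) y := by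
  classical
  have := Fintype.ofFinite β
  let height : α → ℕ := fun y => ({b | e b ≤ y} : Finset β).sup fun b => r b + 1
  have height_mono : Monotone height := fun x y hxy =>
    Finset.sup_mono (Finset.monotone_filter_right _ fun b _ hb => hb.trans hxy)
  obtain ⟨L, hL, hlt⟩ := exists_linearExtension_of_monotone height_mono
  refine ⟨L, hL, fun b y hb => hlt _ _ ?_⟩
  calc height y ≤ r b := Finset.sup_le fun b' hb' => hb b' (by simpa using hb')
    _ < height (e b) := Finset.le_sup (f := fun b => r b + 1) (by simp : b ∈ _)

namespace RanksReverse

theorem extend {ι' : Type*} {r : ι → β → ℕ} (h : RanksReverse e r) {f : ι → ι'}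
    (hf : Function.Injective f) : RanksReverse e (Function.extend f r 0) := fun b y hby =>
  let ⟨i, hi⟩ := h b y hby
  ⟨f i, by simpa only [hf.extend_apply] using hi⟩

theorem reversalNumber_le_card [Fintype ι] {r : ι → β → ℕ} (h : RanksReverse e r) :
    reversalNumber e ≤ Fintype.card ι :=
  Nat.sInf_le ⟨_, h.extend (Fintype.equivFin ι).injective⟩

/-- Only the order of the ranks within each function matters, so they can be taken consecutive. -/
theorem exists_lt_card [Fintype β] {r : ι → β → ℕ} (h : RanksReverse e r) :
    ∃ r' : ι → β → ℕ, RanksReverse e r' ∧ ∀ i b, r' i b < Fintype.card β := by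
  refine ⟨fun i b => ({a | r i a < r i b} : Finset β).card, fun b y hby => ?_, fun i b =>
    Finset.card_lt_univ_of_notMem (x := b) (by simp)⟩
  obtain ⟨i, hi⟩ := h b y hby
  refine ⟨i, fun b' hb' => Finset.card_lt_card ?_⟩
  rw [Finset.ssubset_iff_of_subset (Finset.monotone_filter_right _ fun a _ ha =>
    ha.trans (hi b' hb'))]
  exact ⟨b', by simpa using hi b' hb', by simp⟩

theorem indicator [DecidableEq β] (e : β → α) :
    RanksReverse e fun i b => if i = b then 1 else 0 := fun b y hby =>
  ⟨b, fun b' hb' => by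
    have : b ≠ b' := by rintro rfl; exact hby hb'
    simp [this]⟩

/-- Ranking the family along each member of a realizer. -/
theorem of_isRealizer [Finite β] (e : β → α) {k : ℕ} {L : Fin k → α → α → Prop}
    (hL : IsRealizer α L) : ∃ r : Fin k → β → ℕ, RanksReverse e r := by
  classical
  have := Fintype.ofFinite β
  refine ⟨fun i b => ({a | ¬ L i (e b) (e a)} : Finset β).card, fun b y hby => ?_⟩
  obtain ⟨i, hi⟩ := not_forall.1 (mt (hL.2 (e b) y).2 hby)
  have hLi := hL.1 i
  refine ⟨i, fun b' hb' => Finset.card_lt_card ?_⟩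
  have hbb' : ¬ L i (e b) (e b') := fun h => hi (hLi.trans _ _ _ h (hLi.extends_le _ _ hb'))
  have hsub : ({a | ¬ L i (e b') (e a)} : Finset β) ⊆ ({a | ¬ L i (e b) (e a)} : Finset β) :=
    Finset.monotone_filter_right _ fun a _ ha hba =>
      hbb' (hLi.trans _ _ _ hba ((hLi.total _ _).resolve_left ha))
  rw [Finset.ssubset_iff_of_subset hsub]
  exact ⟨b', by simpa using hbb', by simpa using hLi.refl _⟩

end RanksReverse

theorem reversalNumber_le_card [Fintype β] (e : β → α) : reversalNumber e ≤ Fintype.card β := by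
  classical exact (RanksReverse.indicator e).reversalNumber_le_card

theorem exists_ranksReverse_reversalNumber [Finite β] (e : β → α) :
    ∃ r : Fin (reversalNumber e) → β → ℕ, RanksReverse e r := by
  classical
  have := Fintype.ofFinite β
  exact Nat.sInf_mem (s := {t | ∃ r : Fin t → β → ℕ, RanksReverse e r})
    ⟨_, _, (RanksReverse.indicator e).extend (Fintype.equivFin β).injective⟩

theorem reversalNumber_le_iff [Finite β] {t : ℕ} :
    reversalNumber e ≤ t ↔ ∃ r : Fin t → β → ℕ, RanksReverse e r := by
  refine ⟨fun ht => ?_, fun ⟨r, hr⟩ => by simpa using hr.reversalNumber_le_card⟩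
  obtain ⟨r, hr⟩ := exists_ranksReverse_reversalNumber e
  exact ⟨_, hr.extend (Fin.castLE_injective ht)⟩

theorem posetDim_spec (α : Type*) [PartialOrder α] [Finite α] :
    0 < posetDim α ∧ ∃ L : Fin (posetDim α) → α → α → Prop, IsRealizer α L :=
  Nat.sInf_mem (exists_isRealizer α)

theorem reversalNumber_le_posetDim [Finite α] [Finite β] (e : β → α) :
    reversalNumber e ≤ posetDim α := by
  obtain ⟨-, L, hL⟩ := posetDim_spec α
  exact reversalNumber_le_iff.2 (RanksReverse.of_isRealizer e hL)

theorem posetDim_le_card [Fintype ι] [Nonempty ι] (L : ι → α → α → Prop)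
    (hL : ∀ i, IsLinearExtension α (L i)) (h : ∀ x y, ¬ x ≤ y → ∃ i, ¬ L i x y) :
    posetDim α ≤ Fintype.card ι := by
  refine Nat.sInf_le ⟨Fintype.card_pos, fun i => L ((Fintype.equivFin ι).symm i), fun i => hL _,
    fun x y => ⟨fun hxy i => (hL _).extends_le x y hxy, fun hxy => ?_⟩⟩
  by_contra hn
  obtain ⟨i, hi⟩ := h x y hn
  exact hi (by simpa using hxy (Fintype.equivFin ι i))

theorem posetDim_le_sum_reversalNumber {κ : Type*} [Fintype κ] {β : κ → Type*}
    [∀ q, Finite (β q)] (e : ∀ q, β q → α) (he : ∀ x, ∃ q b, e q b = x) :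
    posetDim α ≤ ∑ q, reversalNumber (e q) + 1 := by
  choose r hr using fun q => exists_ranksReverse_reversalNumber (e q)
  choose L hL hLr using fun q i => exists_linearExtension_of_rank (e q) (r q i)
  obtain ⟨L₀, hL₀, -⟩ := exists_linearExtension_of_monotone
    (monotone_const : Monotone fun _ : α => 0)
  let F : Option (Σ q, Fin (reversalNumber (e q))) → α → α → Prop :=
    fun o => o.elim L₀ fun a => L a.1 a.2
  have hF : ∀ o, IsLinearExtension α (F o) := by
    rintro (_ | a)
    exacts [hL₀, hL _ _]
  have hrev : ∀ x y, ¬ x ≤ y → ∃ o, ¬ F o x y := by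
    intro x y hxy
    obtain ⟨q, b, rfl⟩ := he x
    obtain ⟨i, hi⟩ := hr q b y hxy
    exact ⟨some ⟨q, i⟩, hLr q i b y hi⟩
  simpa using posetDim_le_card F hF hrev

end Reversal

/-! ### The search for rank functions -/

/-- The rank of the `b`-th element of a block of `k` elements in the `i`-th of the tables listed by
the base-`k` digits of `c`. -/
def codeRank (k c i b : ℕ) : ℕ :=
  c / k ^ (k * i + b) % k

theorem exists_digits_eq {k m : ℕ} {g : ℕ → ℕ} (hg : ∀ j < m, g j < k) :
    ∃ c < k ^ m, ∀ j < m, c / k ^ j % k = g j := by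
  obtain ⟨c, hc⟩ := (finFunctionFinEquiv (m := k) (n := m)).symm.surjective fun j => ⟨g j, hg j j.2⟩
  refine ⟨c, c.2, fun j hj => ?_⟩
  rw [← finFunctionFinEquiv_symm_apply_val c ⟨j, hj⟩, hc]

theorem exists_codeRank_eq {k : ℕ} {r : ℕ → ℕ → ℕ} (hr : ∀ i < k, ∀ b < k, r i b < k) :
    ∃ c < k ^ (k * k), ∀ i < k, ∀ b < k, codeRank k c i b = r i b := by
  obtain ⟨c, hc, hdigit⟩ := exists_digits_eq (k := k) (m := k * k)
    (g := fun j => r (j / k) (j % k)) fun j hj =>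
      have hk : 0 < k := Nat.pos_of_mul_pos_right (Nat.zero_lt_of_lt hj)
      hr _ (Nat.div_lt_of_lt_mul hj) _ (Nat.mod_lt _ hk)
  refine ⟨c, hc, fun i hi b hb => (hdigit _ ?_).trans ?_⟩
  · exact Nat.mul_add_lt_mul_of_lt_of_lt hi hb
  · simp [Nat.mul_add_div (Nat.zero_lt_of_lt hb), Nat.div_eq_of_lt hb, Nat.mod_eq_of_lt hb]

namespace FinitePoset

/-- The elements of `P`, ordered by `P.order` instead of the usual order of `Fin P.card`. -/
def Point (P : FinitePoset) : Type :=
  Fin P.card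

variable (P : FinitePoset) (k q : ℕ)

instance : PartialOrder P.Point :=
  P.order

instance : Fintype P.Point :=
  inferInstanceAs (Fintype (Fin P.card))

/-- The element of `P` with the label `i`. -/
def point {P : FinitePoset} {i : ℕ} (hi : i < P.card) : P.Point :=
  ⟨i, hi⟩

/-- The order of `P` in terms of the labels of its elements, false outside the labels. -/
def LabelLE (i j : ℕ) : Prop :=
  ∃ (hi : i < P.card) (hj : j < P.card), point hi ≤ point hj

/-- The `q`-th block of `k` consecutive elements of `P`; the last block may be shorter. -/
def block : {b : Fin k // k * q + b < P.card} → P.Point :=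
  fun b => point b.2

/-- The upper bound for the dimension of `P` which results from cutting `P` into blocks of `k`
elements and determining the reversal number of each of them. -/
noncomputable def approxDim : ℕ :=
  ∑ q ∈ Finset.range (P.card / k + 1), reversalNumber (P.block k q) + 1

/-- The first `t` tables of the code `c` reverse the `q`-th block of `k` elements of `P`. This is
`RanksReverse` with all quantifiers bounded, ready to be decided by a machine. -/
def CodeReverses (t c : ℕ) : Prop :=
  ∀ b < k, ∀ y < P.card, k * q + b < P.card → ¬ P.LabelLE (k * q + b) y →
    ∃ i < t, ∀ b' < k, P.LabelLE (k * q + b') y → codeRank k c i b' < codeRank k c i b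

variable {P k}

theorem labelLE_iff (x y : P.Point) : P.LabelLE x.1 y.1 ↔ x ≤ y :=
  ⟨fun ⟨_, _, h⟩ => h, fun h => ⟨x.2, y.2, h⟩⟩

theorem dim_pos : 0 < P.dim :=
  (posetDim_spec P.Point).1

theorem reversalNumber_block_le_dim : reversalNumber (P.block k q) ≤ P.dim :=
  reversalNumber_le_posetDim _

theorem card_blockIndex_le : Fintype.card {b : Fin k // k * q + b < P.card} ≤ k :=
  (Fintype.card_subtype_le _).trans (Fintype.card_fin k).le

theorem reversalNumber_block_le : reversalNumber (P.block k q) ≤ k :=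
  (reversalNumber_le_card _).trans (card_blockIndex_le q)

theorem exists_block_eq (hk : 0 < k) (x : P.Point) :
    ∃ (q : Fin (P.card / k + 1)) (b : _), P.block k q b = x := by
  obtain ⟨x, hx⟩ : Fin P.card := x
  have hx' : k * (x / k) + x % k = x := Nat.div_add_mod x k
  exact ⟨⟨x / k, Nat.lt_succ_of_le (Nat.div_le_div_right hx.le)⟩,
    ⟨⟨x % k, Nat.mod_lt x hk⟩, hx'.trans_lt hx⟩, Fin.ext hx'⟩

theorem dim_le_approxDim (hk : 0 < k) : P.dim ≤ P.approxDim k := by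
  rw [approxDim, ← Fin.sum_univ_eq_sum_range fun q => reversalNumber (P.block k q)]
  exact posetDim_le_sum_reversalNumber (fun q : Fin (P.card / k + 1) => P.block k q)
    (exists_block_eq hk)

theorem approxDim_le : P.approxDim k ≤ (P.card / k + 2) * P.dim :=
  calc P.approxDim k ≤ ∑ _q ∈ Finset.range (P.card / k + 1), P.dim + P.dim :=
        Nat.add_le_add (Finset.sum_le_sum fun q _ => reversalNumber_block_le_dim q) dim_pos
    _ = (P.card / k + 2) * P.dim := by simp only [Finset.sum_const, Finset.card_range]; ring

theorem CodeReverses.ranksReverse {q t c : ℕ} (h : P.CodeReverses k q t c) :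
    RanksReverse (P.block k q) fun (i : Fin t) b => codeRank k c i b.1 := fun b y hby => by
  obtain ⟨i, hi, hrank⟩ := h b.1 b.1.2 y.1 y.2 b.2 (mt (labelLE_iff (P.block k q _) y).1 hby)
  exact ⟨⟨i, hi⟩, fun b' hb' => hrank b'.1 b'.1.2 ((labelLE_iff (P.block k q _) y).2 hb')⟩

theorem exists_codeReverses {t : ℕ} (htk : t ≤ k) (ht : reversalNumber (P.block k q) ≤ t) :
    ∃ c < k ^ (k * k), P.CodeReverses k q t c := by
  obtain ⟨r₀, hr₀⟩ := reversalNumber_le_iff.1 ht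
  obtain ⟨r, hr, hlt⟩ := hr₀.exists_lt_card
  let table (i b : ℕ) : ℕ :=
    if h : i < t ∧ b < k ∧ k * q + b < P.card then r ⟨i, h.1⟩ ⟨⟨b, h.2.1⟩, h.2.2⟩ else 0
  have table_lt : ∀ i < k, ∀ b < k, table i b < k := fun i _ b hb => by
    dsimp only [table]
    split
    exacts [(hlt _ _).trans_le (card_blockIndex_le q), Nat.zero_lt_of_lt hb]
  have table_eq : ∀ (i : Fin t) (b : {b : Fin k // k * q + b < P.card}),
      table i b.1 = r i b := fun i b => dif_pos ⟨i.2, b.1.2, b.2⟩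
  obtain ⟨c, hc, hcode⟩ := exists_codeRank_eq table_lt
  refine ⟨c, hc, fun b hb y hy hbP hby => ?_⟩
  obtain ⟨i, hi⟩ := hr ⟨⟨b, hb⟩, hbP⟩ (point hy) fun hle => hby ⟨hbP, hy, hle⟩
  refine ⟨i, i.2, fun b' hb' ⟨hb'P, _, hle⟩ => ?_⟩
  rw [hcode i (i.2.trans_le htk) b' hb', hcode i (i.2.trans_le htk) b hb]
  simpa only [← table_eq] using hi ⟨⟨b', hb'⟩, hb'P⟩ hle

theorem lt_reversalNumber_block_iff {t N : ℕ} (htk : t ≤ k) (hN : k ^ (k * k) ≤ N) :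
    t < reversalNumber (P.block k q) ↔ ¬ ∃ c < N, P.CodeReverses k q t c := by
  rw [← not_le, not_iff_not]
  refine ⟨fun ht => ?_, fun ⟨c, _, hc⟩ => reversalNumber_le_iff.2 ⟨_, hc.ranksReverse⟩⟩
  obtain ⟨c, hc, hrev⟩ := exists_codeReverses q htk ht
  exact ⟨c, hc.trans_le hN, hrev⟩

end FinitePoset

/-! ### Polynomial-time computable functions -/

namespace RAM

/-- `Halts p s m Q`: the program `p`, started in the store `s`, halts within `m` units of time in a
store with the property `Q`. -/
def Halts (p : Prog) (s : Store) (m : ℕ) (Q : Store → Prop) : Prop :=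
  ∃ t ≤ m, ∃ s', Exec p s t s' ∧ Q s'

namespace Halts

variable {p p' : Prog} {s : Store} {m m' : ℕ} {Q Q' : Store → Prop}

theorem mono (h : Halts p s m Q) (hm : m ≤ m') : Halts p s m' Q :=
  let ⟨t, ht, s', hs', hQ⟩ := h
  ⟨t, ht.trans hm, s', hs', hQ⟩

theorem seq (h : Halts p s m Q) (h' : ∀ s', Q s' → Halts p' s' m' Q') :
    Halts (.seq p p') s (m + m') Q' :=
  let ⟨_, ht, s', hs', hQ⟩ := h
  let ⟨_, ht', s'', hs'', hQ'⟩ := h' s' hQ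
  ⟨_, add_le_add ht ht', s'', hs'.seq hs'', hQ'⟩

theorem assign {x : ℕ} {e : Expr} (h : Q (s.setVar x (e.eval s))) :
    Halts (.assign x e) s (e.cost + 1) Q :=
  ⟨_, le_rfl, _, .assign s x e, h⟩

theorem assign_seq {x : ℕ} {e : Expr} (h : Halts p (s.setVar x (e.eval s)) m Q) :
    Halts (.seq (.assign x e) p) s (e.cost + 1 + m) Q :=
  seq (assign (Q := (· = s.setVar x (e.eval s))) rfl) fun _ hs => hs ▸ h

theorem loop {I : ℕ → Store → Prop} {e : Expr} {n : ℕ}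
    (he : ∀ i s, I i s → e.eval s = n - i)
    (hp : ∀ i < n, ∀ s, I i s → Halts p s m (I (i + 1))) (hs : I 0 s) :
    Halts (.loop e p) s (n * (e.cost + 1 + m) + (e.cost + 1)) (I n) := by
  suffices ∀ j i s, i + j = n → I i s →
      Halts (.loop e p) s (j * (e.cost + 1 + m) + (e.cost + 1)) (I n) from
    this n 0 s n.zero_add hs
  intro j
  induction j with
  | zero =>
    rintro i s rfl hi
    exact ⟨e.cost + 1, by simp, s, .loop_false (by simp [he _ s hi]), hi⟩
  | succ j ih =>
    intro i s hij hi
    obtain ⟨t, ht, s', hs', hi'⟩ := hp i (by lia) s hi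
    obtain ⟨t', ht', s'', hs'', hn⟩ := ih (i + 1) s' (by lia) hi'
    have hne : e.eval s ≠ 0 := by rw [he i s hi]; lia
    refine ⟨_, ?_, s'', .loop_true hne hs' hs'', hn⟩
    calc e.cost + 1 + t + t'
      _ ≤ e.cost + 1 + m + (j * (e.cost + 1 + m) + (e.cost + 1)) := by gcongr
      _ = (j + 1) * (e.cost + 1 + m) + (e.cost + 1) := by ring

end Halts

/-- The stores agree in all arrays and in the variables below `d`. -/
structure Store.EqBelow (d : ℕ) (s s' : Store) : Prop where
  arr : s'.arr = s.arr
  var : ∀ x < d, s'.var x = s.var x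

namespace Store.EqBelow

variable {d d' : ℕ} {s s' s'' : Store}

theorem refl (d : ℕ) (s : Store) : EqBelow d s s :=
  ⟨rfl, fun _ _ => rfl⟩

theorem trans (h : EqBelow d s s') (h' : EqBelow d s' s'') : EqBelow d s s'' :=
  ⟨h'.arr.trans h.arr, fun x hx => (h'.var x hx).trans (h.var x hx)⟩

theorem mono (h : EqBelow d' s s') (hd : d ≤ d') : EqBelow d s s' :=
  ⟨h.arr, fun x hx => h.var x (hx.trans_le hd)⟩

theorem setVar (h : EqBelow d s s') {x : ℕ} (hx : d ≤ x) (v : ℕ) : EqBelow d s (s'.setVar x v) :=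
  h.trans ⟨rfl, fun _ hy => Function.update_of_ne (hy.trans_le hx).ne _ _⟩

end Store.EqBelow

@[simp] theorem Store.setVar_var (s : Store) (x v : ℕ) :
    (s.setVar x v).var = Function.update s.var x v :=
  rfl

/-- The program computing the value after `n` steps of a recursion, where `n` is the value of the
variable `d`, the start value is in the variable `d + 1`, and `p` performs one step: it finds the
current value in `d + 1` and the number of steps made so far in `d + 2`, and puts the next value
into `d + 3`. The result is put into `d`. -/
def Prog.iterate (d : ℕ) (p : Prog) : Prog :=
  .seq (.assign (d + 2) (.const 0)) <|
    .seq (.loop (.sub (.var d) (.var (d + 2))) <| .seq p <|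
      .seq (.assign (d + 1) (.var (d + 3))) (.assign (d + 2) (.add (.var (d + 2)) (.const 1)))) <|
    .assign d (.var (d + 1))

theorem Halts.iterate {p : Prog} {s s₀ : Store} {d n m : ℕ} {v : ℕ → ℕ} (h₀ : s.EqBelow d s₀)
    (hn : s₀.var d = n) (hv : s₀.var (d + 1) = v 0)
    (hp : ∀ i < n, ∀ s', s.EqBelow d s' → s'.var (d + 1) = v i → s'.var (d + 2) = i →
      Halts p s' m fun s'' => s'.EqBelow (d + 3) s'' ∧ s''.var (d + 3) = v (i + 1)) :
    Halts (.iterate d p) s₀ (n * (m + 10) + 8) fun s' => s.EqBelow d s' ∧ s'.var d = v n := by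
  let I (i : ℕ) (s' : Store) : Prop :=
    s.EqBelow d s' ∧ s'.var d = n ∧ s'.var (d + 1) = v i ∧ s'.var (d + 2) = i
  have test_eval : ∀ i s', I i s' → (Expr.sub (.var d) (.var (d + 2))).eval s' = n - i :=
    fun i s' ⟨_, hn', _, hi'⟩ => congrArg₂ (· - ·) hn' hi'
  have body_spec : ∀ i < n, ∀ s', I i s' → Halts (.seq p <| .seq (.assign (d + 1) (.var (d + 3)))
      (.assign (d + 2) (.add (.var (d + 2)) (.const 1)))) s' (m + 6) (I (i + 1)) := by
    intro i hi s' ⟨hs', hn', hv', hi'⟩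
    refine (hp i hi s' hs' hv' hi').seq fun s₁ ⟨h₁, hv₁⟩ => .assign_seq <| .assign ⟨?_, ?_, ?_, ?_⟩
    · exact ((hs'.trans (h₁.mono (by lia))).setVar (by lia) _).setVar (by lia) _
    · simp [h₁.var, hn']
    · simp [Expr.eval, hv₁]
    · simp [Expr.eval, h₁.var, hi']
  have start : I 0 (s₀.setVar (d + 2) 0) :=
    ⟨h₀.setVar (by lia) _, by simp [hn], by simp [hv], by simp⟩
  have result : ∀ s', I n s' → Halts (.assign d (.var (d + 1))) s' 2 fun s'' =>
      s.EqBelow d s'' ∧ s''.var d = v n := fun s' ⟨hs', _, hv', _⟩ =>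
    .assign ⟨hs'.setVar le_rfl _, by simpa [Expr.eval] using hv'⟩
  refine (Halts.assign_seq ((Halts.loop test_eval body_spec start).seq result)).mono ?_
  simp only [Expr.cost]
  lia

/-- A type whose elements determine an input word together with the values of finitely many
variables, the parameters of a computation. -/
class Context (α : Type*) where
  word : α → List Bool
  params : α → List ℕ

section Feasible

open Context

variable {α : Type*} [Context α]

/-- The length of the input word. -/
def size (a : α) : ℕ :=
  (word a).length

/-- The store `s` holds the input word of `a`, and the parameters of `a` are the values of the
variables listed in `pos`. -/
structure Represents (pos : List ℕ) (a : α) (s : Store) : Prop where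
  arr : s.arr = (input (word a)).arr
  var_zero : s.var 0 = size a
  params : pos.map s.var = params a

theorem Represents.of_eqBelow {pos : List ℕ} {a : α} {s s' : Store} {d : ℕ}
    (h : Represents pos a s) (hd : 0 < d) (hpos : ∀ x ∈ pos, x < d) (hs : s.EqBelow d s') :
    Represents pos a s' :=
  ⟨hs.arr.trans h.arr, (hs.var 0 hd).trans h.var_zero,
    (List.map_congr_left fun x hx => hs.var x (hpos x hx)).trans h.params⟩

/-- The function `f` can be computed in time polynomial in the length of the input word, wherever
the parameters are stored, leaving the arrays and all variables below a given `d` untouched and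
the result in the variable `d`. -/
def Feasible (f : α → ℕ) : Prop :=
  ∀ (pos : List ℕ) (d : ℕ), 0 < d → (∀ x ∈ pos, x < d) →
    ∃ (p : Prog) (T : Polynomial ℕ), ∀ (a : α) (s : Store), Represents pos a s →
      Halts p s (T.eval (size a)) fun s' => s.EqBelow d s' ∧ s'.var d = f a

open Classical in
/-- The predicate `p` can be decided in time polynomial in the length of the input word. -/
def FeasiblePred (p : α → Prop) : Prop :=
  Feasible fun a => if p a then 1 else 0

/-- The context `α` with one more parameter, whose value is subject to the condition `R`. -/
structure Extension (R : α → ℕ → Prop) where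
  base : α
  value : ℕ
  property : R base value

/-- The context `α` with a variable holding the value of `f`. -/
abbrev Let (f : α → ℕ) : Type _ :=
  Extension fun a v => v = f a

/-- The context `α` with a variable running through the numbers less than `m`. -/
abbrev Below (m : α → ℕ) : Type _ :=
  Extension fun a i => i < m a

instance (R : α → ℕ → Prop) : Context (Extension R) where
  word x := word x.base
  params x := x.value :: params x.base

theorem Represents.base {R : α → ℕ → Prop} {pos : List ℕ} {x : Extension R} {s : Store}
    (h : Represents pos x s) : Represents pos.tail x.base s :=
  ⟨h.arr, h.var_zero, by rw [List.map_tail, h.params]; rfl⟩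

theorem Represents.var_head {R : α → ℕ → Prop} {pos : List ℕ} {x : Extension R} {s : Store}
    (h : Represents pos x s) : s.var (pos.headD 0) = x.value := by
  have hparams := h.params
  cases pos with
  | nil => cases hparams
  | cons y pos => exact (List.cons.inj hparams).1

theorem Represents.extend {R : α → ℕ → Prop} {pos : List ℕ} {a : α} {s : Store}
    (h : Represents pos a s) {x v : ℕ} (hv : R a v) (hx : s.var x = v) :
    Represents (x :: pos) (⟨a, v, hv⟩ : Extension R) s :=
  ⟨h.arr, h.var_zero, congrArg₂ List.cons hx h.params⟩

namespace Feasible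

variable {f g m : α → ℕ}

theorem congr (hf : Feasible f) (h : ∀ a, f a = g a) : Feasible g :=
  funext h ▸ hf

theorem of_expr (e : List ℕ → Expr)
    (he : ∀ pos a s, Represents pos a s → (e pos).eval s = f a) : Feasible f :=
  fun pos d _ _ => ⟨.assign d (e pos), .C ((e pos).cost + 1), fun a s hs => by
    rw [Polynomial.eval_C]
    exact .assign ⟨(Store.EqBelow.refl d s).setVar le_rfl _, by simp [he pos a s hs]⟩⟩

protected theorem const (c : ℕ) : Feasible fun _ : α => c :=
  of_expr (fun _ => .const c) fun _ _ _ _ => rfl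

protected theorem size : Feasible (size : α → ℕ) :=
  of_expr (fun _ => .var 0) fun _ _ _ hs => hs.var_zero

protected theorem value {R : α → ℕ → Prop} : Feasible fun x : Extension R => x.value :=
  of_expr (fun pos => .var (pos.headD 0)) fun _ _ _ hs => hs.var_head

protected theorem base (hf : Feasible f) {R : α → ℕ → Prop} :
    Feasible fun x : Extension R => f x.base := fun pos d hd hpos =>
  let ⟨p, T, hT⟩ := hf pos.tail d hd fun x hx => hpos x (List.mem_of_mem_tail hx)
  ⟨p, T, fun x s hs => hT x.base s hs.base⟩

theorem bind (hf : Feasible f) (hg : Feasible fun x : Let f => g x.base) : Feasible g :=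
  fun pos d hd hpos => by
    obtain ⟨p, T, hT⟩ := hf pos d hd hpos
    obtain ⟨p', T', hT'⟩ := hg (d :: pos) (d + 1) (Nat.succ_pos d)
      (List.forall_mem_cons.2 ⟨d.lt_succ_self, fun x hx => (hpos x hx).trans d.lt_succ_self⟩)
    refine ⟨.seq p (.seq p' (.assign d (.var (d + 1)))), T + (T' + .C 2), fun a s hs => ?_⟩
    simp only [Polynomial.eval_add, Polynomial.eval_C]
    refine (hT a s hs).seq fun s₁ ⟨h₁, hd₁⟩ => ?_
    have hs₁ := (hs.of_eqBelow hd hpos h₁).extend (R := fun a v => v = f a) rfl hd₁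
    refine (hT' _ s₁ hs₁).seq fun s₂ ⟨h₂, hd₂⟩ => .assign ⟨?_, ?_⟩
    · exact (h₁.trans (h₂.mono d.le_succ)).setVar le_rfl _
    · simpa [Expr.eval] using hd₂

theorem bind₂ (hf : Feasible f) (hg : Feasible g) {h : α → ℕ} (e : Expr → Expr → Expr)
    (he : ∀ s x y a, s.var x = f a → s.var y = g a → (e (.var x) (.var y)).eval s = h a) :
    Feasible h :=
  hf.bind <| hg.base.bind <| of_expr (fun pos => e (.var (pos.tail.headD 0)) (.var (pos.headD 0)))
    fun _ x _ hs => he _ _ _ _ (hs.base.var_head.trans x.base.property)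
      (hs.var_head.trans x.property)

protected theorem add (hf : Feasible f) (hg : Feasible g) : Feasible fun a => f a + g a :=
  hf.bind₂ hg .add fun _ _ _ _ hx hy => congrArg₂ (· + ·) hx hy

protected theorem sub (hf : Feasible f) (hg : Feasible g) : Feasible fun a => f a - g a :=
  hf.bind₂ hg .sub fun _ _ _ _ hx hy => congrArg₂ (· - ·) hx hy

theorem input_arr (hf : Feasible f) : Feasible fun a => (input (word a)).arr 0 (f a) :=
  hf.bind <| of_expr (fun pos => .get 0 (.var (pos.headD 0))) fun _ x _ hs =>
    congrArg₂ (fun r i => r 0 i) hs.arr (hs.var_head.trans x.property)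

theorem recursion {G : α → ℕ → ℕ} (hm : Feasible m) (hm_le : ∀ a, m a ≤ size a)
    (hG₀ : Feasible fun a => G a 0)
    (hG : Feasible fun x : Let fun y : Below m => G y.base y.value =>
      G x.base.base (x.base.value + 1)) :
    Feasible fun a => G a (m a) := fun pos d hd hpos => by
  have hpos_lt (n : ℕ) : ∀ x ∈ pos, x < d + n := fun x hx => (hpos x hx).trans_le (d.le_add_right n)
  obtain ⟨pₘ, Tₘ, hpₘ⟩ := hm pos d hd hpos
  obtain ⟨p₀, T₀, hp₀⟩ := hG₀ pos (d + 1) (by lia) (hpos_lt 1)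
  obtain ⟨p, T, hp⟩ := hG ((d + 1) :: (d + 2) :: pos) (d + 3) (by lia) (by simpa using hpos_lt 3)
  refine ⟨.seq pₘ (.seq p₀ (.iterate d p)), Tₘ + (T₀ + (.X * (T + .C 10) + .C 8)), fun a s hs => ?_⟩
  simp only [Polynomial.eval_add, Polynomial.eval_mul, Polynomial.eval_C, Polynomial.eval_X]
  refine (hpₘ a s hs).seq fun s₁ ⟨h₁, hm₁⟩ => ?_
  refine (hp₀ a s₁ (hs.of_eqBelow hd hpos h₁)).seq fun s₂ ⟨h₂, hG₂⟩ => ?_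
  have hm₂ : s₂.var d = m a := (h₂.var d d.lt_succ_self).trans hm₁
  have step_spec : ∀ i < m a, ∀ s', s.EqBelow d s' → s'.var (d + 1) = G a i → s'.var (d + 2) = i →
      Halts p s' (T.eval (size a)) fun s'' =>
        s'.EqBelow (d + 3) s'' ∧ s''.var (d + 3) = G a (i + 1) := fun i hi s' hs' hG' hi' =>
    hp _ s' (((hs.of_eqBelow hd hpos hs').extend (R := fun a i => i < m a) hi hi').extend
      (R := fun y v => v = G y.base y.value) rfl hG')
  refine (Halts.iterate (h₁.trans (h₂.mono d.le_succ)) hm₂ hG₂ step_spec).mono ?_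
  gcongr
  exact hm_le a

protected theorem sum (hm : Feasible m) (hm_le : ∀ a, m a ≤ size a) {g : α → ℕ → ℕ}
    (hg : Feasible fun x : Below m => g x.base x.value) :
    Feasible fun a => ∑ i ∈ Finset.range (m a), g a i :=
  recursion (G := fun a n => ∑ i ∈ Finset.range n, g a i) hm hm_le (.const 0) <|
    (Feasible.value.add hg.base).congr fun x => by rw [Finset.sum_range_succ, x.property]

protected theorem mul (hf : Feasible f) (hf_le : ∀ a, f a ≤ size a) (hg : Feasible g) :
    Feasible fun a => f a * g a :=
  (Feasible.sum hf hf_le (g := fun a _ => g a) hg.base).congr fun a => by simp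

theorem mul_add (hf : Feasible f) (hf_le : ∀ a, f a ≤ size a) (hg : Feasible g) (hm : Feasible m) :
    Feasible fun a => f a * g a + m a :=
  (hf.mul hf_le hg).add hm

protected theorem pow (hf : Feasible f) (hf_le : ∀ a, f a ≤ size a) (hg : Feasible g)
    (hg_le : ∀ a, g a ≤ size a) : Feasible fun a => f a ^ g a :=
  recursion (G := fun a n => f a ^ n) hg hg_le (.const 1) <|
    (Feasible.mul hf.base.base (fun x => hf_le x.base.base) .value).congr fun x => by
      rw [pow_succ', x.property]

end Feasible

namespace FeasiblePred

variable {f g m : α → ℕ} {p q : α → Prop}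

theorem congr (hp : FeasiblePred p) (h : ∀ a, p a ↔ q a) : FeasiblePred q :=
  (funext fun a => propext (h a) : p = q) ▸ hp

protected theorem base (hp : FeasiblePred p) {R : α → ℕ → Prop} :
    FeasiblePred fun x : Extension R => p x.base :=
  Feasible.base hp

protected theorem le (hf : Feasible f) (hg : Feasible g) : FeasiblePred fun a => f a ≤ g a :=
  ((Feasible.const 1).sub (hf.sub hg)).congr fun a => by split <;> lia

protected theorem lt (hf : Feasible f) (hg : Feasible g) : FeasiblePred fun a => f a < g a :=
  .le (hf.add (.const 1)) hg

protected theorem not (hp : FeasiblePred p) : FeasiblePred fun a => ¬ p a :=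
  ((Feasible.const 1).sub hp).congr fun a => by split <;> simp [*]

protected theorem imp (hp : FeasiblePred p) (hq : FeasiblePred q) :
    FeasiblePred fun a => p a → q a :=
  ((Feasible.const 1).sub (hp.sub hq)).congr fun a => by split <;> split <;> simp [*]

open Classical in
theorem card_filter (hm : Feasible m) (hm_le : ∀ a, m a ≤ size a) {p : α → ℕ → Prop}
    (hp : FeasiblePred fun x : Below m => p x.base x.value) :
    Feasible fun a => ((Finset.range (m a)).filter (p a)).card :=
  (Feasible.sum hm hm_le (g := fun a i => if p a i then 1 else 0) hp).congr fun _ =>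
    (Finset.card_filter _ _).symm

protected theorem exists_lt (hm : Feasible m) (hm_le : ∀ a, m a ≤ size a) {p : α → ℕ → Prop}
    (hp : FeasiblePred fun x : Below m => p x.base x.value) :
    FeasiblePred fun a => ∃ i < m a, p a i := by
  classical
  exact (FeasiblePred.lt (.const 0) (card_filter hm hm_le hp)).congr fun a => by
    simp [Finset.card_pos, Finset.Nonempty]

protected theorem forall_lt (hm : Feasible m) (hm_le : ∀ a, m a ≤ size a) {p : α → ℕ → Prop}
    (hp : FeasiblePred fun x : Below m => p x.base x.value) :
    FeasiblePred fun a => ∀ i < m a, p a i :=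
  (FeasiblePred.exists_lt hm hm_le (p := fun a i => ¬ p a i) hp.not).not.congr fun a => by
    push Not
    rfl

end FeasiblePred

namespace Feasible

variable {f g m : α → ℕ}

/-- A bounded function is computed by counting the numbers below its values. -/
theorem of_lt (hm : Feasible m) (hm_le : ∀ a, m a ≤ size a) (hf_le : ∀ a, f a ≤ m a)
    (hf : FeasiblePred fun x : Below m => x.value < f x.base) : Feasible f := by
  refine (FeasiblePred.card_filter hm hm_le (p := fun a i => i < f a) hf).congr fun a => ?_
  refine (congrArg Finset.card ?_).trans (Finset.card_range (f a))
  ext i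
  simpa using fun hi : i < f a => hi.trans_le (hf_le a)

protected theorem div (hf : Feasible f) (hf_le : ∀ a, f a ≤ size a) (hg : Feasible g)
    (hg_pos : ∀ a, 0 < g a) : Feasible fun a => f a / g a := by
  refine of_lt hf hf_le (fun a => Nat.div_le_self _ _) ?_
  have hmul : Feasible fun x : Below f => (x.value + 1) * g x.base :=
    .mul (Feasible.value.add (.const 1)) (fun x => x.property.trans_le (hf_le x.base)) hg.base
  exact (FeasiblePred.le hmul hf.base).congr fun x =>
    (Nat.le_div_iff_mul_le (hg_pos x.base)).symm

protected theorem mod (hf : Feasible f) (hf_le : ∀ a, f a ≤ size a) (hg : Feasible g)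
    (hg_pos : ∀ a, 0 < g a) : Feasible fun a => f a % g a :=
  (hf.sub (.mul (hf.div hf_le hg hg_pos) (fun a => (Nat.div_le_self _ _).trans (hf_le a)) hg)).congr
    fun _ => Nat.mod_eq_sub_div_mul.symm

protected theorem sqrt (hf : Feasible f) (hf_le : ∀ a, f a ≤ size a) :
    Feasible fun a => (f a).sqrt := by
  refine of_lt hf hf_le (fun a => Nat.sqrt_le_self _) ?_
  have hsucc : Feasible fun x : Below f => x.value + 1 := Feasible.value.add (.const 1)
  exact (FeasiblePred.le (.mul hsucc (fun x => x.property.trans_le (hf_le x.base)) hsucc)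
    hf.base).congr fun x => Nat.le_sqrt.symm

end Feasible

theorem polyTimeComputable_of_feasible (hα : ∀ a : α, params a = []) {f : α → ℕ}
    (hf : Feasible f) : PolyTimeComputable (word : α → List Bool) f := by
  obtain ⟨p, T, hp⟩ := hf [] 1 one_pos (by simp)
  refine ⟨.seq p (.assign 0 (.var 1)), T + .C 2, fun a => ?_⟩
  obtain ⟨t, ht, s, hs, -, hval⟩ := hp a (input (word a)) ⟨rfl, rfl, (hα a).symm⟩
  exact ⟨_, _, hs.seq (.assign s 0 (.var 1)), by simpa [Expr.cost, size] using ht,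
    by simpa [Expr.eval] using hval⟩

end Feasible

end RAM

/-! ### The algorithm -/

/-- The length of the encoding of a poset on `n` elements. -/
def encodeLength (n : ℕ) : ℕ :=
  n * n + n + 1

/-- The size of the blocks for an input of length `N`: the largest `k` such that all systems of `k`
tables, each ranking `k` elements by numbers less than `k`, are enumerated by the numbers below
`N`. -/
def blockSize (N : ℕ) : ℕ :=
  Nat.findGreatest (fun k => k ^ (k * k) ≤ N) N

section BlockSize

variable {N i k : ℕ}

theorem le_pow_mul_self (k : ℕ) : k * k ≤ k ^ (k * k) := by
  rcases Nat.lt_or_ge k 2 with hk | hk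
  · interval_cases k <;> simp
  · exact ((Nat.lt_pow_self hk).le)

theorem pow_mul_self_mono (h : i ≤ k) : i ^ (i * i) ≤ k ^ (k * k) := by
  rcases Nat.eq_zero_or_pos i with rfl | hi
  · rcases Nat.eq_zero_or_pos k with rfl | hk
    exacts [le_rfl, Nat.one_le_pow _ _ hk]
  · exact (Nat.pow_le_pow_left h _).trans
      (Nat.pow_le_pow_right (hi.trans_le h) (Nat.mul_self_le_mul_self h))

theorem pow_blockSize_le (hN : 0 < N) : blockSize N ^ (blockSize N * blockSize N) ≤ N :=
  Nat.findGreatest_spec (P := fun k => k ^ (k * k) ≤ N) hN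
    (by simpa using hN.nat_succ_le)

theorem le_blockSize_iff (hN : 0 < N) : k ≤ blockSize N ↔ k ^ (k * k) ≤ N :=
  ⟨fun h => (pow_mul_self_mono h).trans (pow_blockSize_le hN), fun h =>
    Nat.le_findGreatest ((Nat.le_mul_self k).trans ((le_pow_mul_self k).trans h)) h⟩

theorem blockSize_pos (hN : 0 < N) : 0 < blockSize N :=
  (le_blockSize_iff hN).2 (by simpa using hN.nat_succ_le)

theorem blockSize_mul_self_le (hN : 0 < N) : blockSize N * blockSize N ≤ N :=
  (le_pow_mul_self _).trans (pow_blockSize_le hN)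

end BlockSize

namespace FinitePoset

open RAM

variable (P : FinitePoset)

theorem length_encode : P.encode.length = encodeLength P.card := by
  simp only [encode, List.length_append, List.length_replicate, List.length_cons,
    List.length_flatMap, List.length_map, List.length_finRange, List.map_const', List.sum_replicate,
    smul_eq_mul, encodeLength]
  ring

theorem sqrt_length_encode : P.encode.length.sqrt = P.card := by
  rw [length_encode, encodeLength, eq_comm, Nat.eq_sqrt]
  have := P.card_pos
  constructor <;> nlinarith

variable {P}

theorem length_encode_pos : 0 < P.encode.length := by
  simp [length_encode, encodeLength]

theorem card_lt_length_encode : P.card < P.encode.length := by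
  rw [length_encode, encodeLength]
  lia

open Classical in
theorem encode_eq : P.encode = List.replicate P.card true ++ false ::
    List.ofFn fun a : Fin (P.card * P.card) => decide (P.LabelLE (a / P.card) (a % P.card)) := by
  rw [encode, List.ofFn_mul', List.flatMap, ← List.ofFn_eq_map]
  simp only [← List.ofFn_eq_map]
  congr! with i j
  rw [Nat.mul_add_div P.card_pos, Nat.div_eq_of_lt j.2, add_zero, Nat.mul_add_mod,
    Nat.mod_eq_of_lt j.2]
  exact (labelLE_iff i j).symm

open Classical in
theorem input_arr_encode {i j : ℕ} (hj : j < P.card) :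
    (input P.encode).arr 0 (P.card + 1 + (P.card * i + j)) = if P.LabelLE i j then 1 else 0 := by
  have hdiv : (P.card * i + j) / P.card = i := by
    rw [Nat.mul_add_div P.card_pos, Nat.div_eq_of_lt hj, add_zero]
  have hmod : (P.card * i + j) % P.card = j := by
    rw [Nat.mul_add_mod, Nat.mod_eq_of_lt hj]
  have hbit : P.encode.getD (P.card + 1 + (P.card * i + j)) false = decide (P.LabelLE i j) := by
    rw [encode_eq, List.getD_append_right _ _ _ _ (by simp; lia), List.length_replicate, add_assoc,
      Nat.add_sub_cancel_left, add_comm 1, List.getD_cons_succ]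
    by_cases h : P.card * i + j < P.card * P.card
    · rw [List.getD_eq_getElem _ _ (by simpa using h)]
      simp [hdiv, hmod]
    · rw [List.getD_eq_default _ _ (by simpa using h)]
      simpa using mt (fun hle => Nat.mul_add_lt_mul_of_lt_of_lt hle.1 hj) h
  simp only [input, hbit, if_true]
  split_ifs with h <;> simp [h]

end FinitePoset

namespace RAM

open Context

variable {α : Type*} [Context α]

theorem Feasible.blockSize {f : α → ℕ} (hf : Feasible f) (hf_le : ∀ a, f a ≤ size a)
    (hf_pos : ∀ a, 0 < f a) : Feasible fun a => blockSize (f a) := by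
  have hsqrt : ∀ x : Below fun a => (f a).sqrt,
      (x.value + 1) * (x.value + 1) ≤ size x := fun x =>
    (Nat.le_sqrt.1 x.property).trans (hf_le x.base)
  have hsucc_le : ∀ x : Below fun a => (f a).sqrt, x.value + 1 ≤ size x := fun x =>
    (Nat.le_mul_self _).trans (hsqrt x)
  refine of_lt (hf.sqrt hf_le) (fun a => (Nat.sqrt_le_self _).trans (hf_le a))
    (fun a => Nat.le_sqrt.2 (blockSize_mul_self_le (hf_pos a))) ?_
  have hsucc : Feasible fun x : Below fun a => (f a).sqrt => x.value + 1 :=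
    Feasible.value.add (.const 1)
  exact (FeasiblePred.le (.pow hsucc hsucc_le (.mul hsucc hsucc_le hsucc) hsqrt) hf.base).congr
    fun x => (le_blockSize_iff (hf_pos x.base)).symm

theorem Feasible.codeRank {k c i b : α → ℕ} (hk : Feasible k) (hc : Feasible c) (hi : Feasible i)
    (hb : Feasible b) (hk_le : ∀ a, k a * k a ≤ size a) (hc_le : ∀ a, c a ≤ size a)
    (hik : ∀ a, i a < k a) (hbk : ∀ a, b a < k a) :
    Feasible fun a => codeRank (k a) (c a) (i a) (b a) := by
  have hk_pos : ∀ a, 0 < k a := fun a => Nat.zero_lt_of_lt (hik a)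
  have hk_le' : ∀ a, k a ≤ size a := fun a => (Nat.le_mul_self _).trans (hk_le a)
  have hexp : ∀ a, k a * i a + b a ≤ size a := fun a =>
    (Nat.mul_add_lt_mul_of_lt_of_lt (hik a) (hbk a)).le.trans (hk_le a)
  exact .mod (.div hc hc_le (.pow hk hk_le' (.mul_add hk hk_le' hi hb) hexp)
    fun a => pow_pos (hk_pos a) _) (fun a => (Nat.div_le_self _ _).trans (hc_le a)) hk hk_pos

section Poset

variable {P : α → FinitePoset}

theorem Feasible.card (hP : ∀ a, word a = (P a).encode) : Feasible fun a => (P a).card :=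
  (Feasible.sqrt .size fun _ => le_rfl).congr fun a => by
    rw [size, hP, FinitePoset.sqrt_length_encode]

theorem card_le_size (hP : ∀ a, word a = (P a).encode) (a : α) : (P a).card ≤ size a := by
  rw [size, hP]
  exact FinitePoset.card_lt_length_encode.le

theorem FeasiblePred.labelLE (hP : ∀ a, word a = (P a).encode) {i j : α → ℕ} (hi : Feasible i)
    (hj : Feasible j) (hj_lt : ∀ a, j a < (P a).card) :
    FeasiblePred fun a => (P a).LabelLE (i a) (j a) :=
  have hn := Feasible.card hP
  (Feasible.input_arr (.add (.add hn (.const 1)) (.mul_add hn (card_le_size hP) hi hj))).congr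
    fun a => by rw [hP, FinitePoset.input_arr_encode (hj_lt a)]

theorem FeasiblePred.exists_codeRank_lt (hP : ∀ a, word a = (P a).encode) {k q t c b y : α → ℕ}
    (hk : Feasible k) (hq : Feasible q) (ht : Feasible t) (hc : Feasible c) (hb : Feasible b)
    (hy : Feasible y) (hk_le : ∀ a, k a * k a ≤ size a) (htk : ∀ a, t a ≤ k a)
    (hc_le : ∀ a, c a ≤ size a) (hbk : ∀ a, b a < k a) (hy_lt : ∀ a, y a < (P a).card) :
    FeasiblePred fun a => ∃ i < t a, ∀ b' < k a, (P a).LabelLE (k a * q a + b') (y a) →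
      codeRank (k a) (c a) i b' < codeRank (k a) (c a) i (b a) := by
  have hk_le' : ∀ a, k a ≤ size a := fun a => (Nat.le_mul_self _).trans (hk_le a)
  refine .exists_lt ht (fun a => (htk a).trans (hk_le' a)) <|
    .forall_lt hk.base (fun _ => hk_le' _) (.imp ?_ (.lt ?_ ?_))
  · exact .labelLE (fun x => hP x.base.base)
      (.mul_add hk.base.base (fun _ => hk_le' _) hq.base.base .value) hy.base.base fun _ => hy_lt _
  · exact .codeRank hk.base.base hc.base.base Feasible.value.base .value (fun _ => hk_le _)
      (fun _ => hc_le _) (fun x => x.base.property.trans_le (htk _)) fun x => x.property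
  · exact .codeRank hk.base.base hc.base.base Feasible.value.base hb.base.base (fun _ => hk_le _)
      (fun _ => hc_le _) (fun x => x.base.property.trans_le (htk _)) fun _ => hbk _

theorem FeasiblePred.codeReverses (hP : ∀ a, word a = (P a).encode) {k q t c : α → ℕ}
    (hk : Feasible k) (hq : Feasible q) (ht : Feasible t) (hc : Feasible c)
    (hk_le : ∀ a, k a * k a ≤ size a) (htk : ∀ a, t a ≤ k a) (hc_le : ∀ a, c a ≤ size a) :
    FeasiblePred fun a => (P a).CodeReverses (k a) (q a) (t a) (c a) := by
  have hk_le' : ∀ a, k a ≤ size a := fun a => (Nat.le_mul_self _).trans (hk_le a)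
  refine .forall_lt hk hk_le' <| .forall_lt (.card fun x => hP x.base)
    (card_le_size (P := fun x : Below k => P x.base) fun x => hP x.base) ?_
  have hlabel : Feasible fun x : Below fun y : Below k => (P y.base).card =>
      k x.base.base * q x.base.base + x.base.value :=
    .mul_add hk.base.base (fun _ => hk_le' _) hq.base.base Feasible.value.base
  have hle := FeasiblePred.labelLE (fun x => hP x.base.base) hlabel .value fun x => x.property
  exact .imp (.lt hlabel (.card fun x => hP x.base.base)) <| .imp hle.not <|
    .exists_codeRank_lt (fun x => hP x.base.base) hk.base.base hq.base.base ht.base.base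
      hc.base.base Feasible.value.base .value (fun _ => hk_le _) (fun _ => htk _)
      (fun _ => hc_le _) (fun x => x.base.property) fun x => x.property

theorem Feasible.reversalNumber_block (hP : ∀ a, word a = (P a).encode) {k q : α → ℕ}
    (hk : Feasible k) (hq : Feasible q) (hk_le : ∀ a, k a ^ (k a * k a) ≤ size a) :
    Feasible fun a => reversalNumber ((P a).block (k a) (q a)) := by
  have hk_mul_le : ∀ a, k a * k a ≤ size a := fun a => (le_pow_mul_self _).trans (hk_le a)
  refine of_lt hk (fun a => (Nat.le_mul_self _).trans (hk_mul_le a))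
    (fun a => FinitePoset.reversalNumber_block_le _) ?_
  have hcode : FeasiblePred fun x : Below k => ∃ c < size x,
      (P x.base).CodeReverses (k x.base) (q x.base) x.value c :=
    .exists_lt .size (fun _ => le_rfl) <| .codeReverses (fun x => hP x.base.base) hk.base.base
      hq.base.base Feasible.value.base .value (fun _ => hk_mul_le _)
      (fun x => x.base.property.le) fun x => x.property.le
  exact hcode.not.congr fun x =>
    (FinitePoset.lt_reversalNumber_block_iff _ x.property.le (hk_le _)).symm

theorem Feasible.approxDim (hP : ∀ a, word a = (P a).encode) {k : α → ℕ} (hk : Feasible k)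
    (hk_pos : ∀ a, 0 < k a) (hk_le : ∀ a, k a ^ (k a * k a) ≤ size a) :
    Feasible fun a => (P a).approxDim (k a) := by
  have hn : Feasible fun a => (P a).card := .card hP
  have hblocks : Feasible fun a => (P a).card / k a + 1 :=
    (hn.div (card_le_size hP) hk hk_pos).add (.const 1)
  have hblocks_le : ∀ a, (P a).card / k a + 1 ≤ size a := fun a => by
    rw [size, hP]
    exact (Nat.succ_le_succ (Nat.div_le_self _ _)).trans FinitePoset.card_lt_length_encode
  exact (Feasible.sum hblocks hblocks_le (.reversalNumber_block (fun x => hP x.base) hk.base .value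
    fun _ => hk_le _)).add (.const 1)

end Poset

noncomputable instance : Context FinitePoset where
  word := FinitePoset.encode
  params _ := []

theorem polyTimeComputable_approxDim : PolyTimeComputable FinitePoset.encode fun P =>
    P.approxDim (blockSize P.encode.length) :=
  have hpos (P : FinitePoset) : 0 < P.encode.length := P.length_encode_pos
  polyTimeComputable_of_feasible (fun _ => rfl) <| .approxDim (fun _ => rfl)
    (.blockSize .size (fun _ => le_rfl) hpos) (fun P => blockSize_pos (hpos P))
    fun P => pow_blockSize_le (hpos P)

end RAM

/-! ### The approximation factor -/

section Asymptotics

open Real Filter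

variable {N n : ℕ}

theorem log_le_blockSize_sq_mul_log (hN : 0 < N) :
    log N ≤ (blockSize N + 1) ^ 2 * log (blockSize N + 1) := by
  have hlt : N ≤ (blockSize N + 1) ^ ((blockSize N + 1) * (blockSize N + 1)) :=
    (not_le.1 (mt (le_blockSize_iff hN).2 (Nat.not_succ_le_self _))).le
  calc log N ≤ log (((blockSize N + 1) ^ ((blockSize N + 1) * (blockSize N + 1)) : ℕ) : ℝ) :=
        log_le_log (by exact_mod_cast hN) (by exact_mod_cast hlt)
    _ = (blockSize N + 1) ^ 2 * log (blockSize N + 1) := by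
        push_cast
        rw [log_pow]
        push_cast
        ring

theorem blockSize_le_log_add_one (hN : 0 < N) : (blockSize N : ℝ) ≤ log N + 1 := by
  have hk : (1 : ℝ) ≤ blockSize N := by exact_mod_cast blockSize_pos hN
  have hlog : (blockSize N : ℝ) ^ 2 * log (blockSize N) ≤ log N := by
    have hpow : ((blockSize N ^ (blockSize N * blockSize N) : ℕ) : ℝ) ≤ N := by
      exact_mod_cast pow_blockSize_le hN
    calc (blockSize N : ℝ) ^ 2 * log (blockSize N)
      _ = log ((blockSize N ^ (blockSize N * blockSize N) : ℕ) : ℝ) := by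
        push_cast
        rw [log_pow]
        push_cast
        ring
      _ ≤ log N := log_le_log (by exact_mod_cast pow_pos (blockSize_pos hN) _) hpow
  calc (blockSize N : ℝ) ≤ blockSize N * (blockSize N - 1) + 1 := by nlinarith
    _ = (blockSize N : ℝ) ^ 2 * (1 - (blockSize N : ℝ)⁻¹) + 1 := by field_simp
    _ ≤ (blockSize N : ℝ) ^ 2 * log (blockSize N) + 1 := by
        gcongr
        exact one_sub_inv_le_log_of_pos (by linarith)
    _ ≤ log N + 1 := by linarith

theorem encodeLength_le_pow (hn : 2 ≤ n) : encodeLength n ≤ n ^ 3 := by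
  rw [encodeLength]
  nlinarith [Nat.mul_le_mul hn hn, Nat.mul_le_mul_right (n * n) hn]

theorem sqrt_log_le_blockSize_mul (hn : 4 ≤ log n) :
    √(log n) ≤ 3 * (blockSize (encodeLength n) * √(log (log n))) := by
  set k := blockSize (encodeLength n)
  have hpos : 0 < encodeLength n := Nat.succ_pos _
  have hk : (1 : ℝ) ≤ k := by exact_mod_cast blockSize_pos hpos
  have hn2 : 2 ≤ n := by
    by_contra! h
    interval_cases n <;> norm_num at hn
  have hlogN : log (encodeLength n) ≤ 3 * log n := by
    calc log (encodeLength n) ≤ log ((n : ℝ) ^ 3) :=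
          log_le_log (by exact_mod_cast hpos) (by exact_mod_cast encodeLength_le_pow hn2)
      _ = 3 * log n := by rw [log_pow]; norm_num
  have hlogk : log (k + 1) ≤ 2 * log (log n) := by
    calc log (k + 1) ≤ log (log n ^ 2) :=
          log_le_log (by linarith) (by nlinarith [blockSize_le_log_add_one hpos])
      _ = 2 * log (log n) := by rw [log_pow]; norm_num
  have hlog : log n ≤ (3 * k) ^ 2 * log (log n) := by
    have hloglog : 0 ≤ log (log n) := log_nonneg (by linarith)
    calc log n ≤ log (encodeLength n) :=
          log_le_log (by positivity) (by exact_mod_cast (by rw [encodeLength]; lia))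
      _ ≤ (k + 1) ^ 2 * log (k + 1) := log_le_blockSize_sq_mul_log hpos
      _ ≤ (k + k) ^ 2 * (2 * log (log n)) := by
        gcongr
        exact log_nonneg (by linarith)
      _ ≤ (3 * k) ^ 2 * log (log n) := by nlinarith [mul_nonneg (sq_nonneg (k : ℝ)) hloglog]
  calc √(log n) ≤ √((3 * k) ^ 2 * log (log n)) := sqrt_le_sqrt hlog
    _ = 3 * (k * √(log (log n))) := by
      rw [sqrt_mul (sq_nonneg _), sqrt_sq (by positivity), mul_assoc]

/-- The approximation factor for posets on `n` elements. -/
noncomputable def approxRatio (n : ℕ) : ℝ :=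
  n / blockSize (encodeLength n) + 2

theorem approxRatio_isBigO : approxRatio =O[atTop]
    fun n : ℕ => (n : ℝ) * √(log (log n)) / √(log n) := by
  have hlog := tendsto_log_atTop.comp (tendsto_natCast_atTop_atTop (R := ℝ))
  refine .of_bound 5 ?_
  filter_upwards [hlog.eventually_ge_atTop 4,
    (tendsto_log_atTop.comp hlog).eventually_ge_atTop 1] with n hn hn'
  simp only [Function.comp_apply] at hn hn'
  have hk : (0 : ℝ) < blockSize (encodeLength n) := by
    exact_mod_cast blockSize_pos (Nat.succ_pos _)
  have hsqrt : 0 < √(log n) := sqrt_pos.2 (by linarith)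
  have hblocks : (n : ℝ) / blockSize (encodeLength n) ≤ 3 * (n * √(log (log n)) / √(log n)) := by
    rw [← mul_div_assoc, div_le_div_iff₀ hk hsqrt]
    nlinarith [mul_le_mul_of_nonneg_left (sqrt_log_le_blockSize_mul hn) n.cast_nonneg]
  have hone : 1 ≤ n * √(log (log n)) / √(log n) := by
    rw [le_div_iff₀ hsqrt, one_mul]
    calc √(log n) ≤ log n := sqrt_le_iff.2 ⟨by linarith, by nlinarith⟩
      _ ≤ n := log_le_self n.cast_nonneg
      _ ≤ n * √(log (log n)) := le_mul_of_one_le_right n.cast_nonneg (one_le_sqrt.2 hn')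
  rw [norm_of_nonneg (by rw [approxRatio]; positivity), norm_of_nonneg (by positivity), approxRatio]
  linarith

end Asymptotics

theorem FinitePoset.approxDim_le_approxRatio_mul_dim (P : FinitePoset) :
    (P.approxDim (blockSize (encodeLength P.card)) : ℝ) ≤ approxRatio P.card * P.dim := by
  set k := blockSize (encodeLength P.card)
  calc (P.approxDim k : ℝ) ≤ ((P.card / k : ℕ) + 2) * P.dim := by exact_mod_cast approxDim_le
    _ ≤ approxRatio P.card * P.dim := by
      rw [approxRatio]
      gcongr
      exact Nat.cast_div_le

/-- There is a polynomial-time approximation algorithm for the dimension of an `n`-element poset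
with approximation factor `O(n √(log log n) / √(log n))`. -/
theorem mainTheorem6 :
    ∃ (ρ : ℕ → ℝ) (f : FinitePoset → ℕ),
      Asymptotics.IsBigO Filter.atTop ρ
        (fun n : ℕ => (n : ℝ) * Real.sqrt (Real.log (Real.log (n : ℝ))) /
          Real.sqrt (Real.log (n : ℝ))) ∧
      RAM.PolyTimeComputable FinitePoset.encode f ∧
      ∀ P : FinitePoset, P.dim ≤ f P ∧ (f P : ℝ) ≤ ρ P.card * (P.dim : ℝ) := by
  refine ⟨approxRatio, fun P => P.approxDim (blockSize P.encode.length), approxRatio_isBigO,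
    RAM.polyTimeComputable_approxDim, fun P => ⟨?_, ?_⟩⟩
  · exact FinitePoset.dim_le_approxDim (blockSize_pos P.length_encode_pos)
  · simpa only [P.length_encode] using P.approxDim_le_approxRatio_mul_dim
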